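/- \textbf{Setting.} Let $\mathcal H_1,\mathcal H_2$ be complex Hilbert spaces with inner products linear in the first entry, and let $I,J$ be countable index sets. $\mathcal H_1\otimes\mathcal H_2$ is the completion of the linear span of the rank one operators $f_1\otimes f_2 : f\mapsto\langle f,f_1\rangle f_2$ from $\mathcal H_1$ to $\mathcal H_2$ with respect to $\langle f_1\otimes f_2,g_1\otimes g_2\rangle=\overline{\langle f_1,g_1\rangle}\,\langle f_2,g_2\rangle$. A family $\Psi=\{\psi_i\}_{i\in I}\subset\mathcal H$ is a \emph{frame} if there are $A,B>0$ with $A\|f\|^2\le\sum_i|\langle f,\psi_i\rangle|^2\le B\|f\|^2$ for all $f\in\mathcal H$; its canonical dual frame is $\widetilde\Psi=\{S^{-1}\psi_i\}_{i\in I}$, where $Sf=\sum_i\langle f,\psi_i\rangle\psi_i$. For families $\Psi,\Phi$ indexed by the same set, $G_{\Psi,\Phi}=(\langle\psi_{i'},\phi_i\rangle)_{(i,i')}$ and $G_\Psi=G_{\Psi,\Psi}$. A \emph{spectral matrix algebra} over $I$ is an involutive Banach algebra $\mathcal A$ of complex $I\times I$ matrices (with matrix product, conjugate transpose, and a complete submultiplicative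 norm invariant under the involution) such that every $A\in\mathcal A$ defines a bounded operator on $\ell^2(I)$; if $A\in\mathcal A$ is invertible in $B(\ell^2(I))$, then $A^{-1}\in\mathcal A$; and if $A\in\mathcal A$ and $|b_{i,j}|\le|a_{i,j}|$ for all $i,j$, then $B\in\mathcal A$ and $\|B\|_{\mathcal A}\le\|A\|_{\mathcal A}$. A frame $\Psi$ is \emph{$\mathcal A$-localised} if $G_\Psi\in\mathcal A$. A weight $w=\{w_i\}$, $w_i>0$, is \emph{$\mathcal A$-admissible} if every $A\in\mathcal A$ defines a bounded operator on $\ell^p_w(I)=\{c: cw\in\ell^p(I)\}$ for every $1\le p\le\infty$. For $1\le p\le\infty$, $c:I\times J\to\mathbb C$ and weights $w_1$ on $I$, $w_2$ on $J$, put $$\|c\|_{\ell^{p,\infty}_{w_1\otimes w_2}}=\sup_{j\in J}\Big(\sum_{i\in I}|c_{i,j}|^p w_{1,i}^p w_{2,j}^p\Big)^{1/p},\qquad \|c\|_{\mathfrak l^{p,\infty}_{w_1\otimes w_2}}=\sup_{i\in I}\Big(\sum_{j\in J}|c_{i,j}|^p w_{1,i}^p w_{2,j}^p\Big)^{1/p},$$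 with suprema in place of the inner sums if $p=\infty$. For frames $\Psi_1=\{\psi_{1,i}\}_{i\in I}$ of $\mathcal H_1$ and $\Psi_2=\{\psi_{2,j}\}_{j\in J}$ of $\mathcal H_2$, the space $\mathcal H^{p,\infty}_{w_1\otimes w_2}(\Psi_1\otimes\Psi_2)$ consists of the equivalence classes $F=[\{F_n\}]$ of sequences in $\mathcal H_1\otimes\mathcal H_2$ such that $k_{i,j}=\lim_n\langle F_n,\widetilde\psi_{1,i}\otimes\widetilde\psi_{2,j}\rangle$ exists for all $(i,j)$ and $\sup_n\big\|\big(\langle F_n,\widetilde\psi_{1,i}\otimes\widetilde\psi_{2,j}\rangle\big)_{i,j}\big\|_{\ell^{p,\infty}_{w_1\otimes w_2}}<\infty$; two such sequences $\{F_n\},\{F_n'\}$ are equivalent if $\lim_n\langle F_n-F_n',\widetilde\psi_{1,i}\otimes\widetilde\psi_{2,j}\rangle=0$ for all $(i,j)$. Its norm is $\|F\|=\|k\|_{\ell^{p,\infty}_{w_1\otimes w_2}}$. The space $\mathfrak H^{p,\infty}_{w_1\otimes w_2}(\Psi_1\otimes\Psi_2)$ is defined in the same way with $\mathfrak l^{p,\infty}_{w_1\otimes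 w_2}$ in place of $\ell^{p,\infty}_{w_1\otimes w_2}$. \textbf{Statement.} Let $1\le p\le\infty$. Let $\mathcal A_1$ and $\mathcal A_2$ be spectral matrix algebras over $I$ and $J$ respectively and, for $n=1,2$, let $\Psi_n,\Phi_n\subset\mathcal H_n$ be $\mathcal A_n$-localised frames and $w_n$ an $\mathcal A_n$-admissible weight. If $G_{\Phi_n,\widetilde\Psi_n}\in\mathcal A_n$ and $G_{\Psi_n,\widetilde\Phi_n}\in\mathcal A_n$ for $n=1,2$, then $$\mathcal H^{p,\infty}_{w_1\otimes w_2}(\Psi_1\otimes\Psi_2)=\mathcal H^{p,\infty}_{w_1\otimes w_2}(\Phi_1\otimes\Phi_2)\quad\text{and}\quad \mathfrak H^{p,\infty}_{w_1\otimes w_2}(\Psi_1\otimes\Psi_2)=\mathfrak H^{p,\infty}_{w_1\otimes w_2}(\Phi_1\otimes\Phi_2)$$ as sets of equivalence classes of sequences in $\mathcal H_1\otimes\mathcal H_2$, and in both cases the two norms are equivalent. -/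

import Mathlib

open Filter Topology
open scoped ENNReal NNReal TensorProduct Matrix InnerProductSpace

noncomputable section

namespace Coorbit

/-! ### The tensor product of two Hilbert spaces

The simple tensor `f₁ ⊗ f₂` is the rank one operator `f ↦ ⟨f, f₁⟩ f₂`, hence conjugate linear in
`f₁`. The dual of `H₁` is the conjugate Hilbert space of `H₁`, through `f₁ ↦ ⟨·, f₁⟩`. -/

section Tensor

variable {H H₁ H₂ : Type*}
  [NormedAddCommGroup H] [InnerProductSpace ℂ H] [CompleteSpace H]
  [NormedAddCommGroup H₁] [InnerProductSpace ℂ H₁] [CompleteSpace H₁]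
  [NormedAddCommGroup H₂] [InnerProductSpace ℂ H₂]

variable (H) in
/-- The dual of `H`, with the usual operator norm. -/
def ConjDual : Type _ := StrongDual ℂ H

instance instNormedAddCommGroupConjDual : NormedAddCommGroup (ConjDual H) :=
  inferInstanceAs (NormedAddCommGroup (StrongDual ℂ H))

instance instNormedSpaceConjDual : NormedSpace ℂ (ConjDual H) :=
  inferInstanceAs (NormedSpace ℂ (StrongDual ℂ H))

/-- The functional `⟨·, f⟩`, as the Riesz isomorphism from `H` onto its dual. -/
def toConjDual : H ≃ₗᵢ⋆[ℂ] ConjDual H := InnerProductSpace.toDual ℂ H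

/-- The dual of a complex Hilbert space as an inner product space: the inner product of
`⟨·, f⟩` and `⟨·, g⟩` is the complex conjugate of that of `f` and `g`. -/
instance instInnerProductSpaceConjDual : InnerProductSpace ℂ (ConjDual H) where
  inner ℓ m := inner ℂ (toConjDual.symm m) (toConjDual.symm ℓ)
  norm_sq_eq_re_inner ℓ := by
    rw [← norm_sq_eq_re_inner (𝕜 := ℂ), LinearIsometryEquiv.norm_map]
  conj_inner_symm ℓ m := inner_conj_symm _ _
  add_left ℓ m k := by
    rw [map_add, inner_add_right]
  smul_left ℓ m r := by
    rw [map_smulₛₗ, inner_smul_right]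

variable (H₁ H₂) in
/-- The Hilbert space tensor product `H₁ ⊗ H₂`: the completion of the linear span of the simple
tensors with respect to the inner product given in `inner_simpleTensor`. -/
abbrev HilbertTensor : Type _ :=
  UniformSpace.Completion (ConjDual H₁ ⊗[ℂ] H₂)

/-- The simple tensor `f₁ ⊗ f₂`, conjugate linear in `f₁` and linear in `f₂`. -/
def simpleTensor (f₁ : H₁) (f₂ : H₂) : HilbertTensor H₁ H₂ :=
  ((toConjDual f₁ ⊗ₜ[ℂ] f₂ : ConjDual H₁ ⊗[ℂ] H₂) : HilbertTensor H₁ H₂)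

/-- `⟨g₁ ⊗ g₂, f₁ ⊗ f₂⟩ = conj ⟨g₁, f₁⟩ * ⟨g₂, f₂⟩` for inner products linear in the first
entry; Mathlib's `inner ℂ x y` is `⟨y, x⟩` in that convention. -/
theorem inner_simpleTensor (f₁ g₁ : H₁) (f₂ g₂ : H₂) :
    inner ℂ (simpleTensor f₁ f₂) (simpleTensor g₁ g₂)
      = (starRingEnd ℂ) (inner ℂ f₁ g₁) * inner ℂ f₂ g₂ := by
  rw [simpleTensor, simpleTensor, UniformSpace.Completion.inner_coe, TensorProduct.inner_tmul]
  congr 1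
  change inner ℂ (toConjDual.symm (toConjDual g₁)) (toConjDual.symm (toConjDual f₁)) = _
  simp

end Tensor

/-! ### Frames -/

section Frames

variable {I H : Type*} [NormedAddCommGroup H] [InnerProductSpace ℂ H]

/-- `ψ` is a frame: `A ‖f‖² ≤ ∑ᵢ |⟨f, ψᵢ⟩|² ≤ B ‖f‖²` for all `f`, with `A, B > 0`. -/
def IsFrame (ψ : I → H) : Prop :=
  ∃ A B : ℝ, 0 < A ∧ 0 < B ∧ ∀ f : H,
    Summable (fun i => ‖inner ℂ (ψ i) f‖ ^ 2) ∧
    A * ‖f‖ ^ 2 ≤ ∑' i, ‖inner ℂ (ψ i) f‖ ^ 2 ∧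
    ∑' i, ‖inner ℂ (ψ i) f‖ ^ 2 ≤ B * ‖f‖ ^ 2

/-- The frame operator `S f = ∑ᵢ ⟨f, ψᵢ⟩ ψᵢ`; the series converges for every frame. -/
def frameOperator (ψ : I → H) (f : H) : H :=
  ∑' i, (inner ℂ (ψ i) f : ℂ) • ψ i

/-- The canonical dual `ψ̃ᵢ = S⁻¹ ψᵢ`; the frame operator of a frame of a Hilbert space is
a bijection, so that `Function.invFun` is its inverse. -/
def canonicalDual (ψ : I → H) (i : I) : H :=
  Function.invFun (frameOperator ψ) (ψ i)

/-- The cross Gram matrix `G_{Ψ,Φ} = (⟨ψ_{i'}, φ_i⟩)_{(i,i')}`. -/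
def crossGram (ψ φ : I → H) : Matrix I I ℂ :=
  Matrix.of fun i i' => inner ℂ (φ i) (ψ i')

/-- The Gram matrix `G_Ψ = (⟨ψ_{i'}, ψ_i⟩)_{(i,i')}`. -/
def gram (ψ : I → H) : Matrix I I ℂ := crossGram ψ ψ

end Frames

/-! ### Spectral matrix algebras and weights -/

section Algebras

variable {I : Type*}

/-- The product of two infinite matrices. -/
def infMul (A B : Matrix I I ℂ) : Matrix I I ℂ :=
  Matrix.of fun i j => ∑' k, A i k * B k j

/-- The bounded operator `T` on `ℓ²(I)` is given by the infinite matrix `A`. -/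
def Represents (A : Matrix I I ℂ)
    (T : lp (fun _ : I => ℂ) 2 →L[ℂ] lp (fun _ : I => ℂ) 2) : Prop :=
  ∀ (c : lp (fun _ : I => ℂ) 2) (i : I), HasSum (fun j => A i j * c j) (T c i)

variable (I) in
/-- A (solid) spectral matrix algebra: an involutive Banach algebra of infinite matrices (with
matrix multiplication and the conjugate transpose) that is contained in `B(ℓ²(I))`,
inverse-closed there, and solid. -/
structure SpectralMatrixAlgebra where
  /-- the matrices in the algebra -/
  carrier : Submodule ℂ (Matrix I I ℂ)
  /-- the norm of the algebra -/
  nrm : Seminorm ℂ carrier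
  eq_zero_of_nrm_eq_zero : ∀ A : carrier, nrm A = 0 → A = 0
  complete : ∀ u : ℕ → carrier,
    (∀ ε : ℝ, 0 < ε → ∃ N, ∀ m ≥ N, ∀ n ≥ N, nrm (u m - u n) < ε) →
      ∃ A : carrier, Tendsto (fun n => nrm (u n - A)) atTop (𝓝 0)
  mul_mem : ∀ A B : carrier, infMul (A : Matrix I I ℂ) (B : Matrix I I ℂ) ∈ carrier
  nrm_mul_le : ∀ A B : carrier, nrm ⟨_, mul_mem A B⟩ ≤ nrm A * nrm B
  star_mem : ∀ A : carrier, (A : Matrix I I ℂ)ᴴ ∈ carrier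
  nrm_star : ∀ A : carrier, nrm ⟨_, star_mem A⟩ = nrm A
  bounded : ∀ A ∈ carrier, ∃ T : lp (fun _ : I => ℂ) 2 →L[ℂ] lp (fun _ : I => ℂ) 2,
    Represents A T
  inverse_closed : ∀ A ∈ carrier, ∀ (B : Matrix I I ℂ)
    (T : lp (fun _ : I => ℂ) 2 ≃L[ℂ] lp (fun _ : I => ℂ) 2),
    Represents A (T : lp (fun _ : I => ℂ) 2 →L[ℂ] lp (fun _ : I => ℂ) 2) →
    Represents B (T.symm : lp (fun _ : I => ℂ) 2 →L[ℂ] lp (fun _ : I => ℂ) 2) → B ∈ carrier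
  solid : ∀ (A : carrier) (B : Matrix I I ℂ), (∀ i j, ‖B i j‖ ≤ ‖(A : Matrix I I ℂ) i j‖) →
    ∃ hB : B ∈ carrier, nrm ⟨B, hB⟩ ≤ nrm A

/-- The `ℓ^p`-norm, possibly infinite, of a family in `[0, ∞]`. -/
def elpNorm {ι : Type*} (p : ℝ≥0∞) (a : ι → ℝ≥0∞) : ℝ≥0∞ :=
  if p = ∞ then ⨆ i, a i else (∑' i, a i ^ p.toReal) ^ (1 / p.toReal)

/-- The norm of `ℓ^p_w(I)`, infinite outside that space. -/
def weightedNorm (p : ℝ≥0∞) (w : I → ℝ) (c : I → ℂ) : ℝ≥0∞ :=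
  elpNorm p fun i => ‖c i‖ₑ * ENNReal.ofReal (w i)

/-- The matrix `A` defines a bounded operator on `ℓ^p_w(I)`. -/
def DefinesBoundedOperator (A : Matrix I I ℂ) (p : ℝ≥0∞) (w : I → ℝ) : Prop :=
  ∃ C : ℝ≥0, ∀ c : I → ℂ, weightedNorm p w c < ∞ →
    (∀ i, Summable fun j => A i j * c j) ∧
    weightedNorm p w (fun i => ∑' j, A i j * c j) ≤ C * weightedNorm p w c

/-- `w` is an `𝒜`-admissible weight. -/
def IsAdmissibleWeight (𝒜 : SpectralMatrixAlgebra I) (w : I → ℝ) : Prop :=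
  (∀ i, 0 < w i) ∧
  ∀ A ∈ 𝒜.carrier, ∀ p : ℝ≥0∞, 1 ≤ p → DefinesBoundedOperator A p w

/-- `ψ` is an `𝒜`-localised frame. -/
def IsLocalisedFrame {H : Type*} [NormedAddCommGroup H] [InnerProductSpace ℂ H]
    (𝒜 : SpectralMatrixAlgebra I) (ψ : I → H) : Prop :=
  IsFrame ψ ∧ gram ψ ∈ 𝒜.carrier

end Algebras

/-! ### Mixed-norm co-orbit spaces -/

section Spaces

variable {I J H₁ H₂ : Type*}
  [NormedAddCommGroup H₁] [InnerProductSpace ℂ H₁] [CompleteSpace H₁]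
  [NormedAddCommGroup H₂] [InnerProductSpace ℂ H₂]

/-- The norm of `ℓ^{p,q}_{w₁⊗w₂}(I × J)`: inner `ℓ^p`-norm over `i`, outer `ℓ^q`-norm over `j`. -/
def mixedNorm (p q : ℝ≥0∞) (w₁ : I → ℝ) (w₂ : J → ℝ) (c : I → J → ℂ) : ℝ≥0∞ :=
  elpNorm q fun j => elpNorm p fun i => ‖c i j‖ₑ * ENNReal.ofReal (w₁ i * w₂ j)

/-- The norm of `𝔩^{p,q}_{w₁⊗w₂}(I × J)`: inner `ℓ^p`-norm over `j`, outer `ℓ^q`-norm over `i`. -/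
def mixedNormSwap (p q : ℝ≥0∞) (w₁ : I → ℝ) (w₂ : J → ℝ) (c : I → J → ℂ) : ℝ≥0∞ :=
  elpNorm q fun i => elpNorm p fun j => ‖c i j‖ₑ * ENNReal.ofReal (w₁ i * w₂ j)

/-- The coefficients `⟨F, ψ̃_{1,i} ⊗ ψ̃_{2,j}⟩` of `F ∈ H₁ ⊗ H₂` with respect to the canonical
dual frame of `Ψ₁ ⊗ Ψ₂`. -/
def analysis (ψ₁ : I → H₁) (ψ₂ : J → H₂) (F : HilbertTensor H₁ H₂) (i : I) (j : J) : ℂ :=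
  inner ℂ (simpleTensor (canonicalDual ψ₁ i) (canonicalDual ψ₂ j)) F

/-- Two sequences in `H₁ ⊗ H₂` are equivalent if the coefficients of their difference tend to
zero. -/
def SeqEquiv (ψ₁ : I → H₁) (ψ₂ : J → H₂) (F F' : ℕ → HilbertTensor H₁ H₂) : Prop :=
  ∀ i j, Tendsto (fun n => analysis ψ₁ ψ₂ (F n - F' n) i j) atTop (𝓝 0)

/-- The sequences that represent an element of the space belonging to the sequence space norm
`N`: their coefficients converge, and the norms of their coefficients are bounded. -/
def IsRepresentative (N : (I → J → ℂ) → ℝ≥0∞) (ψ₁ : I → H₁) (ψ₂ : J → H₂)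
    (F : ℕ → HilbertTensor H₁ H₂) : Prop :=
  (∀ i j, ∃ k : ℂ, Tendsto (fun n => analysis ψ₁ ψ₂ (F n) i j) atTop (𝓝 k)) ∧
  ⨆ n, N (analysis ψ₁ ψ₂ (F n)) < ∞

/-- The equivalence class of `F` among the representing sequences. -/
def seqClass (N : (I → J → ℂ) → ℝ≥0∞) (ψ₁ : I → H₁) (ψ₂ : J → H₂)
    (F : ℕ → HilbertTensor H₁ H₂) : Set (ℕ → HilbertTensor H₁ H₂) :=
  {F' | IsRepresentative N ψ₁ ψ₂ F' ∧ SeqEquiv ψ₁ ψ₂ F F'}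

/-- The set of all equivalence classes of representing sequences. The linear structure is that
of the representing sequences, so it is determined by this set of classes. -/
def classSpace (N : (I → J → ℂ) → ℝ≥0∞) (ψ₁ : I → H₁) (ψ₂ : J → H₂) :
    Set (Set (ℕ → HilbertTensor H₁ H₂)) :=
  {K | ∃ F, IsRepresentative N ψ₁ ψ₂ F ∧ K = seqClass N ψ₁ ψ₂ F}

/-- The coefficients `k_{i,j}` of a class: the limits of the coefficients of any representing
sequence. -/
def classCoeff (ψ₁ : I → H₁) (ψ₂ : J → H₂) (K : Set (ℕ → HilbertTensor H₁ H₂))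
    (i : I) (j : J) : ℂ :=
  limUnder atTop fun n => analysis ψ₁ ψ₂ (Classical.epsilon (fun F => F ∈ K) n) i j

/-- The coefficients of a class do not depend on the representing sequence. -/
theorem tendsto_classCoeff (N : (I → J → ℂ) → ℝ≥0∞) (ψ₁ : I → H₁) (ψ₂ : J → H₂)
    {K : Set (ℕ → HilbertTensor H₁ H₂)} (hK : K ∈ classSpace N ψ₁ ψ₂)
    {F : ℕ → HilbertTensor H₁ H₂} (hF : F ∈ K) (i : I) (j : J) :
    Tendsto (fun n => analysis ψ₁ ψ₂ (F n) i j) atTop (𝓝 (classCoeff ψ₁ ψ₂ K i j)) := by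
  have hE : Classical.epsilon (fun F => F ∈ K) ∈ K :=
    Classical.epsilon_spec (p := fun F => F ∈ K) ⟨F, hF⟩
  set E := Classical.epsilon (fun F => F ∈ K) with hEdef
  obtain ⟨F₀, -, rfl⟩ := hK
  have h1 := hF.2 i j
  have h2 := hE.2 i j
  have h3 : Tendsto (fun n => analysis ψ₁ ψ₂ (E n) i j) atTop
      (𝓝 (classCoeff ψ₁ ψ₂ (seqClass N ψ₁ ψ₂ F₀) i j)) :=
    tendsto_nhds_limUnder (hE.1.1 i j)
  have h4 := (h2.sub h1).add h3
  simp only [analysis, inner_sub_right] at h4 ⊢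
  simpa using h4

/-- The space `ℋ^{p,∞}_{w₁⊗w₂}(Ψ₁ ⊗ Ψ₂)`. -/
def coorbitSpace (p : ℝ≥0∞) (w₁ : I → ℝ) (w₂ : J → ℝ) (ψ₁ : I → H₁) (ψ₂ : J → H₂) :
    Set (Set (ℕ → HilbertTensor H₁ H₂)) :=
  classSpace (mixedNorm p ∞ w₁ w₂) ψ₁ ψ₂

/-- The norm of `ℋ^{p,∞}_{w₁⊗w₂}(Ψ₁ ⊗ Ψ₂)`. -/
def coorbitNorm (p : ℝ≥0∞) (w₁ : I → ℝ) (w₂ : J → ℝ) (ψ₁ : I → H₁) (ψ₂ : J → H₂)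
    (K : Set (ℕ → HilbertTensor H₁ H₂)) : ℝ≥0∞ :=
  mixedNorm p ∞ w₁ w₂ (classCoeff ψ₁ ψ₂ K)

/-- The space `ℌ^{p,∞}_{w₁⊗w₂}(Ψ₁ ⊗ Ψ₂)`. -/
def coorbitSpaceSwap (p : ℝ≥0∞) (w₁ : I → ℝ) (w₂ : J → ℝ) (ψ₁ : I → H₁) (ψ₂ : J → H₂) :
    Set (Set (ℕ → HilbertTensor H₁ H₂)) :=
  classSpace (mixedNormSwap p ∞ w₁ w₂) ψ₁ ψ₂

/-- The norm of `ℌ^{p,∞}_{w₁⊗w₂}(Ψ₁ ⊗ Ψ₂)`. -/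
def coorbitNormSwap (p : ℝ≥0∞) (w₁ : I → ℝ) (w₂ : J → ℝ) (ψ₁ : I → H₁) (ψ₂ : J → H₂)
    (K : Set (ℕ → HilbertTensor H₁ H₂)) : ℝ≥0∞ :=
  mixedNormSwap p ∞ w₁ w₂ (classCoeff ψ₁ ψ₂ K)

end Spaces

end Coorbit

end

namespace Coorbit

/-! ### Frames -/

section FrameExpansion

variable {I H : Type*} [NormedAddCommGroup H] [InnerProductSpace ℂ H]

/-! Expanding each `φ̃` in the dual frame, `φ̃ᵢ = ∑ₖ ⟨φ̃ᵢ, ψₖ⟩ ψ̃ₖ`, shows that the coefficients of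
`F ∈ H₁ ⊗ H₂` against `φ̃₁ ⊗ φ̃₂` arise from those against `ψ̃₁ ⊗ ψ̃₂` by the tensor product of the
matrices `conj G_{Ψ₁,Φ̃₁}` and `G_{Ψ₂,Φ̃₂}` (`hasSum_analysis`). Everything follows from two
properties of this matrix.

It is bounded on both mixed-norm spaces: by solidity the moduli of the Gram entries still act on
weighted `ℓ^p` (`IsAdmissibleWeight.isBoundedKernel`), and Minkowski's inequality lets the two
factors act one index at a time (`elpNorm_tensor_kernel_le`).

It also commutes with coefficientwise limits of norm-bounded sequences: the mixed norm dominates the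
weighted supremum norm, and the rows of the matrix are summable against the inverse weights, so
dominated convergence applies (`tendsto_analysis`). Hence representatives, equivalence and limit
coefficients all pass from `Ψ` to `Φ` with norm control. Exchanging `Ψ` and `Φ` gives the reverse
passage. -/

theorem IsFrame.memℓp {ψ : I → H} (hψ : IsFrame ψ) (f : H) :
    Memℓp (fun i => (inner ℂ (ψ i) f : ℂ)) 2 := by
  obtain ⟨A, B, -, -, h⟩ := hψ
  refine memℓp_gen ?_
  simpa using (h f).1

/-- The coefficients of `f` with respect to a frame, as a bounded operator into `ℓ²`. -/
theorem IsFrame.exists_analysisOperator {ψ : I → H} (hψ : IsFrame ψ) :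
    ∃ T : H →L[ℂ] lp (fun _ : I => ℂ) 2, ∀ f i, T f i = inner ℂ (ψ i) f := by
  have hmem := hψ.memℓp
  obtain ⟨A, B, -, hB, h⟩ := hψ
  let T₀ : H →ₗ[ℂ] lp (fun _ : I => ℂ) 2 :=
    { toFun := fun f => ⟨fun i => inner ℂ (ψ i) f, hmem f⟩
      map_add' := fun f g => by
        ext i
        exact inner_add_right _ _ _
      map_smul' := fun r f => by
        ext i
        exact inner_smul_right _ _ _ }
  refine ⟨T₀.mkContinuous (√B) fun f => ?_, fun f i => rfl⟩
  refine le_of_sq_le_sq ?_ (by positivity)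
  have h2 := lp.norm_rpow_eq_tsum (p := 2) (by norm_num) (T₀ f)
  norm_num at h2
  rw [h2, mul_pow, Real.sq_sqrt hB.le]
  exact (h f).2.2

theorem IsFrame.exists_frameOperator [CompleteSpace H] {ψ : I → H} (hψ : IsFrame ψ) :
    ∃ S : H ≃L[ℂ] H, ∀ f, HasSum (fun i => (inner ℂ (ψ i) f : ℂ) • ψ i) (S f) := by
  classical
  obtain ⟨T, hT⟩ := hψ.exists_analysisOperator
  obtain ⟨A, B, hA, -, h⟩ := hψ
  -- The adjoint is the synthesis operator, so `T* T` will be the frame operator.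
  have hsingle : ∀ (i : I) (a : ℂ),
      ContinuousLinearMap.adjoint T (lp.single 2 i a) = a • ψ i := by
    intro i a
    refine ext_inner_right ℂ fun f => ?_
    rw [ContinuousLinearMap.adjoint_inner_left, lp.inner_single_left, hT, inner_smul_left]
    simp [mul_comm]
  -- The lower frame bound says that `T* T` is coercive with constant `A`, which gives
  -- invertibility.
  have hS : IsUnit (ContinuousLinearMap.adjoint T ∘L T) := by
    refine ContinuousLinearMap.isUnit_of_forall_le_norm_inner_map _
      (c := ⟨A, hA.le⟩) hA fun f => ?_
    rw [ContinuousLinearMap.comp_apply, ContinuousLinearMap.adjoint_inner_left,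
      inner_self_eq_norm_sq_to_K]
    have h2 := lp.norm_rpow_eq_tsum (p := 2) (by norm_num) (T f)
    norm_num at h2
    have h3 := (h f).2.1
    simp only [hT] at h2
    rw [← h2] at h3
    rw [mul_comm]
    simpa using! h3
  obtain ⟨u, hu⟩ := hS
  refine ⟨ContinuousLinearEquiv.ofUnit u, fun f => ?_⟩
  have h1 := (lp.hasSum_single (p := 2) (by norm_num) (T f)).mapL (ContinuousLinearMap.adjoint T)
  simp only [hsingle, hT] at h1
  have h2 : (ContinuousLinearEquiv.ofUnit u) f = ContinuousLinearMap.adjoint T (T f) := by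
    change (u : H →L[ℂ] H) f = _
    rw [hu]
    rfl
  rwa [h2]

/-- Reconstruction from the frame coefficients by the canonical dual frame. -/
theorem IsFrame.hasSum_canonicalDual [CompleteSpace H] {ψ : I → H} (hψ : IsFrame ψ) (f : H) :
    HasSum (fun i => (inner ℂ (ψ i) f : ℂ) • canonicalDual ψ i) f := by
  obtain ⟨S, hS⟩ := hψ.exists_frameOperator
  have hop : frameOperator ψ = S := funext fun f => (hS f).tsum_eq
  have hdual : ∀ i, canonicalDual ψ i = S.symm (ψ i) := by
    intro i
    apply S.injective
    rw [canonicalDual, hop, S.apply_symm_apply]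
    exact Function.invFun_eq (S.surjective (ψ i))
  -- Applying `S⁻¹` termwise to the series for `S f` turns each `ψ i` into its dual vector.
  have h := (hS f).mapL (S.symm : H →L[ℂ] H)
  simpa [hdual] using h

end FrameExpansion

/-! ### Simple tensors -/

section Simple

variable {I J H₁ H₂ : Type*}
  [NormedAddCommGroup H₁] [InnerProductSpace ℂ H₁] [CompleteSpace H₁]
  [NormedAddCommGroup H₂] [InnerProductSpace ℂ H₂]

theorem norm_simpleTensor (f : H₁) (g : H₂) : ‖simpleTensor f g‖ = ‖f‖ * ‖g‖ := by
  rw [simpleTensor, UniformSpace.Completion.norm_coe, TensorProduct.norm_tmul,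
    LinearIsometryEquiv.norm_map]

/-- For fixed `g` and `F`, the continuous linear functional `f ↦ ⟨F, f ⊗ g⟩`. -/
theorem exists_inner_simpleTensor_left (g : H₂) (F : HilbertTensor H₁ H₂) :
    ∃ ℓ : H₁ →L[ℂ] ℂ, ∀ f, ℓ f = inner ℂ (simpleTensor f g) F := by
  let ℓ₀ : H₁ →ₗ[ℂ] ℂ :=
    { toFun := fun f => inner ℂ (simpleTensor f g) F
      map_add' := fun f f' => by
        rw [← inner_add_left]
        simp only [simpleTensor, map_add, TensorProduct.add_tmul, UniformSpace.Completion.coe_add]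
      map_smul' := fun r f => by
        simp only [simpleTensor, map_smulₛₗ, ← TensorProduct.smul_tmul',
          UniformSpace.Completion.coe_smul, inner_smul_left]
        simp }
  refine ⟨ℓ₀.mkContinuous (‖g‖ * ‖F‖) fun f => ?_, fun f => rfl⟩
  refine (norm_inner_le_norm (𝕜 := ℂ) (simpleTensor f g) F).trans_eq ?_
  rw [norm_simpleTensor]
  ring

/-- For fixed `f` and `F`, the continuous linear functional `g ↦ ⟨f ⊗ g, F⟩`. -/
theorem exists_inner_simpleTensor_right (f : H₁) (F : HilbertTensor H₁ H₂) :
    ∃ ℓ : H₂ →L[ℂ] ℂ, ∀ g, ℓ g = inner ℂ F (simpleTensor f g) := by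
  let ℓ₀ : H₂ →ₗ[ℂ] ℂ :=
    { toFun := fun g => inner ℂ F (simpleTensor f g)
      map_add' := fun g g' => by
        rw [← inner_add_right]
        simp only [simpleTensor, TensorProduct.tmul_add, UniformSpace.Completion.coe_add]
      map_smul' := fun r g => by
        simp only [simpleTensor, TensorProduct.tmul_smul,
          UniformSpace.Completion.coe_smul, inner_smul_right]
        simp }
  refine ⟨ℓ₀.mkContinuous (‖F‖ * ‖f‖) fun g => ?_, fun g => rfl⟩
  refine (norm_inner_le_norm (𝕜 := ℂ) F (simpleTensor f g)).trans_eq ?_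
  rw [norm_simpleTensor]
  ring

/-- The pairing is linear in `f`: conjugate linearity of the tensor in its first factor cancels that
of Mathlib's inner product in its first slot. So the frame coefficient appears unconjugated. -/
theorem IsFrame.hasSum_inner_simpleTensor_left {ψ : I → H₁} (hψ : IsFrame ψ) (f : H₁) (g : H₂)
    (F : HilbertTensor H₁ H₂) :
    HasSum (fun k => (inner ℂ (ψ k) f : ℂ) * inner ℂ (simpleTensor (canonicalDual ψ k) g) F)
      (inner ℂ (simpleTensor f g) F) := by
  obtain ⟨ℓ, hℓ⟩ := exists_inner_simpleTensor_left g F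
  have h := (hψ.hasSum_canonicalDual f).mapL ℓ
  simp only [map_smul, smul_eq_mul] at h
  simpa only [hℓ] using h

theorem IsFrame.hasSum_inner_simpleTensor_right [CompleteSpace H₂] {ψ : J → H₂} (hψ : IsFrame ψ)
    (f : H₁) (g : H₂) (F : HilbertTensor H₁ H₂) :
    HasSum (fun l => (inner ℂ g (ψ l) : ℂ) * inner ℂ (simpleTensor f (canonicalDual ψ l)) F)
      (inner ℂ (simpleTensor f g) F) := by
  obtain ⟨ℓ, hℓ⟩ := exists_inner_simpleTensor_right f F
  -- In the second factor the pairing is conjugate linear, so the expansion goes through the linear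
  -- functional `ℓ` and is then conjugated.
  have h := ((hψ.hasSum_canonicalDual g).mapL ℓ).map (starRingEnd ℂ) Complex.continuous_conj
  simp only [map_smul, smul_eq_mul, Function.comp_def, map_mul] at h
  simpa only [hℓ, inner_conj_symm] using h

end Simple

/-! ### The norm `elpNorm` -/

section ElpNorm

variable {ι κ : Type*} {p : ℝ≥0∞}

theorem elpNorm_mono {a b : ι → ℝ≥0∞} (h : ∀ i, a i ≤ b i) : elpNorm p a ≤ elpNorm p b := by
  unfold elpNorm
  split_ifs
  · exact iSup_mono h
  · gcongr with i
    exact h i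

theorem le_elpNorm (hp : 1 ≤ p) (a : ι → ℝ≥0∞) (i : ι) : a i ≤ elpNorm p a := by
  unfold elpNorm
  split_ifs with h
  · exact le_iSup a i
  · have hpos : 0 < p.toReal := ENNReal.toReal_pos (by positivity) h
    rw [one_div, ENNReal.le_rpow_inv_iff hpos]
    exact ENNReal.le_tsum i

theorem elpNorm_mul_right (hp : 1 ≤ p) (a : ι → ℝ≥0∞) (c : ℝ≥0∞) :
    elpNorm p (fun i => a i * c) = elpNorm p a * c := by
  unfold elpNorm
  split_ifs with h
  · rw [ENNReal.iSup_mul]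
  · have hpos : 0 < p.toReal := ENNReal.toReal_pos (by positivity) h
    simp_rw [ENNReal.mul_rpow_of_nonneg _ _ hpos.le]
    rw [ENNReal.tsum_mul_right, ENNReal.mul_rpow_of_nonneg _ _ (by positivity), one_div,
      ENNReal.rpow_rpow_inv hpos.ne']

theorem sum_rpow_le_elpNorm (h : p ≠ ∞) (s : Finset ι) (a : ι → ℝ≥0∞) :
    (∑ i ∈ s, a i ^ p.toReal) ^ (1 / p.toReal) ≤ elpNorm p a := by
  rw [elpNorm, if_neg h]
  gcongr
  exact ENNReal.sum_le_tsum s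

/-- Minkowski's inequality for infinite sums. -/
theorem elpNorm_tsum_le (hp : 1 ≤ p) (b : κ → ι → ℝ≥0∞) :
    elpNorm p (fun i => ∑' k, b k i) ≤ ∑' k, elpNorm p (b k) := by
  by_cases h : p = ∞
  · simp only [elpNorm, if_pos h]
    exact iSup_le fun i => ENNReal.tsum_le_tsum fun k => le_iSup (b k) i
  have hp1 : 1 ≤ p.toReal := by
    simpa using ENNReal.toReal_mono h hp
  have hpos : 0 < p.toReal := by linarith
  -- Minkowski for finite sets of both indices; then `t` exhausts `κ` by continuity of powers, and
  -- the supremum over `s` is taken.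
  have hfin : ∀ (s : Finset ι) (t : Finset κ),
      (∑ i ∈ s, (∑ k ∈ t, b k i) ^ p.toReal) ^ (1 / p.toReal) ≤ ∑' k, elpNorm p (b k) := by
    intro s t
    refine le_trans ?_ (ENNReal.sum_le_tsum t)
    induction t using Finset.cons_induction with
    | empty => simp [hpos]
    | cons k t hk ih =>
      simp only [Finset.sum_cons]
      refine (ENNReal.Lp_add_le s _ _ hp1).trans ?_
      exact add_le_add (sum_rpow_le_elpNorm h s _) ih
  have hs : ∀ s : Finset ι,
      (∑ i ∈ s, (∑' k, b k i) ^ p.toReal) ^ (1 / p.toReal) ≤ ∑' k, elpNorm p (b k) := by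
    intro s
    refine le_of_tendsto' (f := fun t : Finset κ =>
      (∑ i ∈ s, (∑ k ∈ t, b k i) ^ p.toReal) ^ (1 / p.toReal)) (x := atTop) ?_ (hfin s)
    refine (ENNReal.continuous_rpow_const.tendsto _).comp (tendsto_finsetSum _ fun i _ => ?_)
    exact (ENNReal.continuous_rpow_const.tendsto _).comp ENNReal.summable.hasSum
  rw [elpNorm, if_neg h, one_div, ENNReal.rpow_inv_le_iff hpos]
  rw [ENNReal.tsum_eq_iSup_sum]
  refine iSup_le fun s => ?_
  rw [← ENNReal.rpow_inv_le_iff hpos, ← one_div]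
  exact hs s

end ElpNorm

/-! ### Positive kernels -/

section Kernels

variable {I J : Type*}

/-- The nonnegative kernel `a` acts on weighted `ℓ^p`. -/
def IsBoundedKernel (p : ℝ≥0∞) (w : I → ℝ) (a : I → I → ℝ≥0∞) : Prop :=
  ∃ C : ℝ≥0, ∀ x : I → ℝ≥0∞,
    elpNorm p (fun i => (∑' k, a i k * x k) * ENNReal.ofReal (w i))
      ≤ C * elpNorm p (fun k => x k * ENNReal.ofReal (w k))

/-- By solidity, the modulus of a matrix of the algebra acts on `ℓ^p_w` for admissible `w`. -/
theorem IsAdmissibleWeight.isBoundedKernel {𝒜 : SpectralMatrixAlgebra I} {w : I → ℝ}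
    (hw : IsAdmissibleWeight 𝒜 w) {M : Matrix I I ℂ} (hM : M ∈ 𝒜.carrier) {p : ℝ≥0∞}
    (hp : 1 ≤ p) : IsBoundedKernel p w fun i k => ‖M i k‖ₑ := by
  obtain ⟨hB, -⟩ := 𝒜.solid ⟨M, hM⟩ (Matrix.of fun i k => (‖M i k‖ : ℂ)) (by simp)
  obtain ⟨C, hC⟩ := hw.2 _ hB p hp
  -- A nonzero constant keeps the right side infinite when the norm of `x` is infinite.
  refine ⟨max C 1, fun x => ?_⟩
  set R := elpNorm p (fun k => x k * ENNReal.ofReal (w k)) with hR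
  by_cases htop : R = ∞
  · rw [htop, ENNReal.mul_top]
    · exact le_top
    · simp
  -- Positive weights make a family of finite norm finite entrywise, so it is the modulus of a
  -- complex sequence.
  have hx : ∀ k, x k ≠ ∞ := by
    intro k hk
    have h1 := le_elpNorm hp (fun k => x k * ENNReal.ofReal (w k)) k
    rw [← hR, hk, ENNReal.top_mul (by simpa using hw.1 k)] at h1
    exact htop (top_le_iff.1 h1)
  set c : I → ℂ := fun k => ((x k).toReal : ℂ) with hc
  have hcx : ∀ k, ‖c k‖ₑ = x k := by
    intro k
    rw [hc, ← ofReal_norm]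
    simp [hx k]
  have hcR : weightedNorm p w c = R := by simp only [weightedNorm, hcx, hR]
  obtain ⟨hsum, hle⟩ := hC c (by rw [hcR]; exact lt_top_iff_ne_top.2 htop)
  -- With nonnegative entries there is no cancellation: the modulus of the complex sum is the sum of
  -- the moduli.
  have hterm : ∀ i, ∑' k, ‖M i k‖ₑ * x k
      = ‖∑' k, (Matrix.of fun i k => (‖M i k‖ : ℂ)) i k * c k‖ₑ := by
    intro i
    have h1 : (fun k => (Matrix.of fun i k => (‖M i k‖ : ℂ)) i k * c k)
        = fun k => ((‖M i k‖ * (x k).toReal : ℝ) : ℂ) := by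
      funext k
      simp [hc]
    have h2 := hsum i
    rw [h1] at h2 ⊢
    rw [Complex.summable_ofReal] at h2
    rw [← Complex.ofReal_tsum, ← ofReal_norm, Complex.norm_real,
      Real.norm_of_nonneg (tsum_nonneg fun k => by positivity),
      ENNReal.ofReal_tsum_of_nonneg (fun k => by positivity) h2]
    refine tsum_congr fun k => ?_
    rw [ENNReal.ofReal_mul (norm_nonneg _), ofReal_norm, ENNReal.ofReal_toReal (hx k)]
  simp only [hterm]
  rw [hcR] at hle
  refine hle.trans ?_
  gcongr
  exact le_max_left _ _

/-- The kernel is tested on `1 / w`, of norm at most one in weighted `ℓ^∞`. The finite sum is what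
makes the majorant in `tendsto_analysis` summable. -/
theorem IsBoundedKernel.tsum_mul_inv_ne_top {w : I → ℝ} (hw : ∀ i, 0 < w i)
    {a : I → I → ℝ≥0∞} (ha : IsBoundedKernel ∞ w a) (i : I) :
    ∑' k, a i k * (ENNReal.ofReal (w k))⁻¹ ≠ ∞ := by
  obtain ⟨C, hC⟩ := ha
  have hpos : ∀ k, ENNReal.ofReal (w k) ≠ 0 := fun k => by simpa using hw k
  have h1 := (le_elpNorm le_top _ i).trans (hC fun k => (ENNReal.ofReal (w k))⁻¹)
  have h2 : elpNorm ∞ (fun k => (ENNReal.ofReal (w k))⁻¹ * ENNReal.ofReal (w k)) ≤ 1 := by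
    rw [elpNorm, if_pos rfl]
    exact iSup_le fun k => (ENNReal.inv_mul_cancel (hpos k) ENNReal.ofReal_ne_top).le
  intro htop
  rw [htop, ENNReal.top_mul (hpos i)] at h1
  have h3 : (C : ℝ≥0∞) * elpNorm ∞
      (fun k => (ENNReal.ofReal (w k))⁻¹ * ENNReal.ofReal (w k)) < ∞ :=
    ENNReal.mul_lt_top ENNReal.coe_lt_top (h2.trans_lt ENNReal.one_lt_top)
  exact absurd h1 (not_le.2 h3)

/-- Minkowski pulls the sum over `l` out of the inner norm. For each fixed `l` the kernel `a` then
acts in the inner variable, at cost `C₁`, and `b` acts on the resulting family of inner norms, at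
cost `C₂`. -/
theorem elpNorm_tensor_kernel_le {w₁ : I → ℝ} {w₂ : J → ℝ} (hw₁ : ∀ i, 0 < w₁ i)
    {p q : ℝ≥0∞} (hp : 1 ≤ p) (hq : 1 ≤ q) {a : I → I → ℝ≥0∞} {b : J → J → ℝ≥0∞}
    (ha : IsBoundedKernel p w₁ a) (hb : IsBoundedKernel q w₂ b) :
    ∃ C : ℝ≥0, ∀ x : I → J → ℝ≥0∞,
      elpNorm q (fun j => elpNorm p fun i =>
        (∑' k, ∑' l, a i k * b j l * x k l) * ENNReal.ofReal (w₁ i * w₂ j))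
      ≤ C * elpNorm q (fun l => elpNorm p fun k => x k l * ENNReal.ofReal (w₁ k * w₂ l)) := by
  obtain ⟨C₁, hC₁⟩ := ha
  obtain ⟨C₂, hC₂⟩ := hb
  refine ⟨C₂ * C₁, fun x => ?_⟩
  have hsplit : ∀ (y : I → ℝ≥0∞) (j : J),
      elpNorm p (fun i => y i * ENNReal.ofReal (w₁ i * w₂ j))
        = elpNorm p (fun i => y i * ENNReal.ofReal (w₁ i)) * ENNReal.ofReal (w₂ j) := by
    intro y j
    rw [← elpNorm_mul_right hp]
    congr 1
    funext i
    rw [ENNReal.ofReal_mul (hw₁ i).le, mul_assoc]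
  simp only [hsplit]
  set n : J → ℝ≥0∞ := fun l =>
    elpNorm p fun i => (∑' k, a i k * x k l) * ENNReal.ofReal (w₁ i) with hn
  have hstep : ∀ j, elpNorm p (fun i =>
      (∑' k, ∑' l, a i k * b j l * x k l) * ENNReal.ofReal (w₁ i)) ≤ ∑' l, b j l * n l := by
    intro j
    have heq : (fun i => (∑' k, ∑' l, a i k * b j l * x k l) * ENNReal.ofReal (w₁ i))
        = fun i => ∑' l, (∑' k, a i k * x k l) * ENNReal.ofReal (w₁ i) * b j l := by
      funext i
      rw [ENNReal.tsum_comm, ← ENNReal.tsum_mul_right]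
      refine tsum_congr fun l => ?_
      rw [mul_right_comm, ← ENNReal.tsum_mul_right, ← ENNReal.tsum_mul_right,
        ← ENNReal.tsum_mul_right]
      exact tsum_congr fun k => by rw [mul_right_comm (a i k)]
    rw [heq]
    refine (elpNorm_tsum_le hp _).trans_eq (tsum_congr fun l => ?_)
    rw [elpNorm_mul_right hp, mul_comm]
  calc elpNorm q (fun j => elpNorm p (fun i =>
          (∑' k, ∑' l, a i k * b j l * x k l) * ENNReal.ofReal (w₁ i)) * ENNReal.ofReal (w₂ j))
      ≤ elpNorm q (fun j => (∑' l, b j l * n l) * ENNReal.ofReal (w₂ j)) :=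
        elpNorm_mono fun j => by gcongr; exact hstep j
    _ ≤ elpNorm q (fun j => (∑' l, b j l * (C₁ * elpNorm p fun k =>
          x k l * ENNReal.ofReal (w₁ k))) * ENNReal.ofReal (w₂ j)) :=
        elpNorm_mono fun j => by gcongr with l; exact hC₁ _
    _ ≤ C₂ * elpNorm q (fun l => (C₁ * elpNorm p fun k =>
          x k l * ENNReal.ofReal (w₁ k)) * ENNReal.ofReal (w₂ l)) := hC₂ _
    _ = _ := by
        rw [ENNReal.coe_mul, mul_assoc (C₂ : ℝ≥0∞), mul_comm (C₁ : ℝ≥0∞) (elpNorm q _),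
          ← elpNorm_mul_right hq]
        congr 2
        funext l
        rw [mul_comm (C₁ : ℝ≥0∞), mul_right_comm]

end Kernels

/-! ### Change of frames -/

section Transfer

variable {I J H₁ H₂ : Type*}
  [NormedAddCommGroup H₁] [InnerProductSpace ℂ H₁] [CompleteSpace H₁]
  [NormedAddCommGroup H₂] [InnerProductSpace ℂ H₂] [CompleteSpace H₂]
  {ψ₁ : I → H₁} {ψ₂ : J → H₂}

/-- The frame expansions give only an iterated sum. Absolute convergence, assumed as `hfin`,
identifies it with the unordered sum over `I × J`. -/
theorem hasSum_analysis (hψ₁ : IsFrame ψ₁) (hψ₂ : IsFrame ψ₂) (φ₁ : I → H₁) (φ₂ : J → H₂)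
    (F : HilbertTensor H₁ H₂) (i : I) (j : J)
    (hfin : ∑' k, ∑' l, ‖crossGram ψ₁ (canonicalDual φ₁) i k‖ₑ *
      ‖crossGram ψ₂ (canonicalDual φ₂) j l‖ₑ * ‖analysis ψ₁ ψ₂ F k l‖ₑ ≠ ∞) :
    HasSum (fun x : I × J => (starRingEnd ℂ) (crossGram ψ₁ (canonicalDual φ₁) i x.1) *
      crossGram ψ₂ (canonicalDual φ₂) j x.2 * analysis ψ₁ ψ₂ F x.1 x.2)
      (analysis φ₁ φ₂ F i j) := by
  have hs : Summable (fun x : I × J => (starRingEnd ℂ) (crossGram ψ₁ (canonicalDual φ₁) i x.1) *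
      crossGram ψ₂ (canonicalDual φ₂) j x.2 * analysis ψ₁ ψ₂ F x.1 x.2) := by
    refine Summable.of_enorm ?_
    simpa only [ENNReal.tsum_prod', enorm_mul, RCLike.enorm_conj] using hfin
  have h1 := hs.hasSum.prod_fiberwise fun k => by
    have h := (hψ₂.hasSum_inner_simpleTensor_right (canonicalDual ψ₁ k) (canonicalDual φ₂ j)
      F).mul_left ((starRingEnd ℂ) (crossGram ψ₁ (canonicalDual φ₁) i k))
    simp only [← mul_assoc] at h
    exact h
  have h2 := hψ₁.hasSum_inner_simpleTensor_left (canonicalDual φ₁ i) (canonicalDual φ₂ j) F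
  have h3 : (fun k => (starRingEnd ℂ) (crossGram ψ₁ (canonicalDual φ₁) i k) *
      inner ℂ (simpleTensor (canonicalDual ψ₁ k) (canonicalDual φ₂ j)) F) =
      fun k => (inner ℂ (ψ₁ k) (canonicalDual φ₁ i) : ℂ) *
        inner ℂ (simpleTensor (canonicalDual ψ₁ k) (canonicalDual φ₂ j)) F := by
    funext k
    rw [crossGram, Matrix.of_apply, inner_conj_symm]
  rw [h3] at h1
  have h4 : analysis φ₁ φ₂ F i j = _ := h2.unique h1
  rw [h4]
  exact hs.hasSum

/-- Trivial when the right side is infinite; otherwise the triangle inequality for the double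
series. Thus no growth condition on `F` is required. -/
theorem enorm_analysis_le (hψ₁ : IsFrame ψ₁) (hψ₂ : IsFrame ψ₂) (φ₁ : I → H₁) (φ₂ : J → H₂)
    (F : HilbertTensor H₁ H₂) (i : I) (j : J) :
    ‖analysis φ₁ φ₂ F i j‖ₑ ≤ ∑' k, ∑' l, ‖crossGram ψ₁ (canonicalDual φ₁) i k‖ₑ *
      ‖crossGram ψ₂ (canonicalDual φ₂) j l‖ₑ * ‖analysis ψ₁ ψ₂ F k l‖ₑ := by
  by_cases hfin : ∑' k, ∑' l, ‖crossGram ψ₁ (canonicalDual φ₁) i k‖ₑ *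
      ‖crossGram ψ₂ (canonicalDual φ₂) j l‖ₑ * ‖analysis ψ₁ ψ₂ F k l‖ₑ = ∞
  · rw [hfin]
    exact le_top
  rw [← (hasSum_analysis hψ₁ hψ₂ φ₁ φ₂ F i j hfin).tsum_eq]
  refine enorm_tsum_le_tsum_enorm.trans_eq ?_
  simp only [ENNReal.tsum_prod', enorm_mul, RCLike.enorm_conj]

/-- Dominated convergence in the double series. Only a uniform weighted supremum bound enters, so
the kernels are needed at exponent `∞` whatever `p` is. -/
theorem tendsto_analysis (hψ₁ : IsFrame ψ₁) (hψ₂ : IsFrame ψ₂) (φ₁ : I → H₁) (φ₂ : J → H₂)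
    {w₁ : I → ℝ} {w₂ : J → ℝ} (hw₁ : ∀ i, 0 < w₁ i) (hw₂ : ∀ j, 0 < w₂ j)
    (h₁ : IsBoundedKernel ∞ w₁ fun i k => ‖crossGram ψ₁ (canonicalDual φ₁) i k‖ₑ)
    (h₂ : IsBoundedKernel ∞ w₂ fun j l => ‖crossGram ψ₂ (canonicalDual φ₂) j l‖ₑ)
    {F : ℕ → HilbertTensor H₁ H₂} {R : ℝ≥0∞} (hR : R ≠ ∞)
    (hF : ∀ n k l, ‖analysis ψ₁ ψ₂ (F n) k l‖ₑ * ENNReal.ofReal (w₁ k * w₂ l) ≤ R)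
    {κ : I → J → ℂ} (hκ : ∀ k l, Tendsto (fun n => analysis ψ₁ ψ₂ (F n) k l) atTop (𝓝 (κ k l)))
    (i : I) (j : J) :
    Tendsto (fun n => analysis φ₁ φ₂ (F n) i j) atTop
      (𝓝 (∑' x : I × J, (starRingEnd ℂ) (crossGram ψ₁ (canonicalDual φ₁) i x.1) *
        crossGram ψ₂ (canonicalDual φ₂) j x.2 * κ x.1 x.2)) := by
  set a := fun k => ‖crossGram ψ₁ (canonicalDual φ₁) i k‖ₑ with ha
  set b := fun l => ‖crossGram ψ₂ (canonicalDual φ₂) j l‖ₑ with hb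
  -- The majorant replaces each coefficient by its largest value `R / (w₁ w₂)`; its sum then factors
  -- over the two indices.
  set g : I × J → ℝ≥0∞ := fun x =>
    a x.1 * b x.2 * (R * (ENNReal.ofReal (w₁ x.1))⁻¹ * (ENNReal.ofReal (w₂ x.2))⁻¹) with hg
  have hcoef : ∀ n k l, ‖analysis ψ₁ ψ₂ (F n) k l‖ₑ
      ≤ R * (ENNReal.ofReal (w₁ k))⁻¹ * (ENNReal.ofReal (w₂ l))⁻¹ := by
    intro n k l
    have hp₁ : ENNReal.ofReal (w₁ k) ≠ 0 := by simpa using hw₁ k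
    have hp₂ : ENNReal.ofReal (w₂ l) ≠ 0 := by simpa using hw₂ l
    rw [← div_eq_mul_inv, ← div_eq_mul_inv,
      ENNReal.le_div_iff_mul_le (Or.inl hp₂) (Or.inl ENNReal.ofReal_ne_top),
      ENNReal.le_div_iff_mul_le (Or.inl hp₁) (Or.inl ENNReal.ofReal_ne_top), mul_assoc,
      mul_comm (ENNReal.ofReal (w₂ l)), ← ENNReal.ofReal_mul (hw₁ k).le]
    exact hF n k l
  have hgsum : ∑' x, g x ≠ ∞ := by
    have heq : ∑' x, g x = R * ((∑' k, a k * (ENNReal.ofReal (w₁ k))⁻¹) *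
        ∑' l, b l * (ENNReal.ofReal (w₂ l))⁻¹) := by
      rw [ENNReal.tsum_prod', ← ENNReal.tsum_mul_right, ← ENNReal.tsum_mul_left]
      refine tsum_congr fun k => ?_
      rw [← ENNReal.tsum_mul_left, ← ENNReal.tsum_mul_left]
      refine tsum_congr fun l => ?_
      simp only [hg]
      ring
    rw [heq]
    exact ENNReal.mul_ne_top hR (ENNReal.mul_ne_top (h₁.tsum_mul_inv_ne_top hw₁ i)
      (h₂.tsum_mul_inv_ne_top hw₂ j))
  have hterm : ∀ n (x : I × J), ‖(starRingEnd ℂ) (crossGram ψ₁ (canonicalDual φ₁) i x.1) *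
      crossGram ψ₂ (canonicalDual φ₂) j x.2 * analysis ψ₁ ψ₂ (F n) x.1 x.2‖ₑ ≤ g x := by
    intro n x
    simp only [enorm_mul, RCLike.enorm_conj]
    exact mul_le_mul_right (hcoef n x.1 x.2) _
  have hsum : ∀ n, ∑' x : I × J, (starRingEnd ℂ) (crossGram ψ₁ (canonicalDual φ₁) i x.1) *
      crossGram ψ₂ (canonicalDual φ₂) j x.2 * analysis ψ₁ ψ₂ (F n) x.1 x.2
      = analysis φ₁ φ₂ (F n) i j := by
    intro n
    refine (hasSum_analysis hψ₁ hψ₂ φ₁ φ₂ (F n) i j (ne_top_of_le_ne_top hgsum ?_)).tsum_eq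
    rw [ENNReal.tsum_prod']
    exact ENNReal.tsum_le_tsum fun k => ENNReal.tsum_le_tsum fun l =>
      mul_le_mul_right (hcoef n k l) _
  simp only [← hsum]
  refine tendsto_tsum_of_dominated_convergence (bound := fun x => (g x).toReal)
    (ENNReal.summable_toReal hgsum) (fun x => (hκ x.1 x.2).const_mul _)
    (Eventually.of_forall fun n x => ?_)
  rw [← toReal_enorm]
  exact ENNReal.toReal_mono (ENNReal.ne_top_of_tsum_ne_top hgsum x) (hterm n x)

end Transfer

/-! ### Independence of the co-orbit spaces of the frames -/

section Independence

variable {I J H₁ H₂ : Type*}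
  [NormedAddCommGroup H₁] [InnerProductSpace ℂ H₁] [CompleteSpace H₁]
  [NormedAddCommGroup H₂] [InnerProductSpace ℂ H₂] [CompleteSpace H₂]
  {N : (I → J → ℂ) → ℝ≥0∞} {w₁ : I → ℝ} {w₂ : J → ℝ}
  {ψ₁ φ₁ : I → H₁} {ψ₂ φ₂ : J → H₂}

/-- `N` dominates the weighted supremum norm, and the tensor product of the kernels `a` and `b`
acts boundedly with respect to `N`, with constant `C`. -/
structure IsCompatibleNorm (N : (I → J → ℂ) → ℝ≥0∞) (w₁ : I → ℝ) (w₂ : J → ℝ)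
    (a : I → I → ℝ≥0∞) (b : J → J → ℝ≥0∞) (C : ℝ≥0) : Prop where
  enorm_mul_le : ∀ c k l, ‖c k l‖ₑ * ENNReal.ofReal (w₁ k * w₂ l) ≤ N c
  apply_le : ∀ c d : I → J → ℂ,
    (∀ i j, ‖d i j‖ₑ ≤ ∑' k, ∑' l, a i k * b j l * ‖c k l‖ₑ) → N d ≤ C * N c

/-- The analytic conditions for passing from coefficients with respect to `ψ₁ ⊗ ψ₂` to those with
respect to `φ₁ ⊗ φ₂`. -/
structure IsTransferable (N : (I → J → ℂ) → ℝ≥0∞) (w₁ : I → ℝ) (w₂ : J → ℝ)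
    (ψ₁ φ₁ : I → H₁) (ψ₂ φ₂ : J → H₂) (C : ℝ≥0) : Prop where
  frame₁ : IsFrame ψ₁
  frame₂ : IsFrame ψ₂
  pos₁ : ∀ i, 0 < w₁ i
  pos₂ : ∀ j, 0 < w₂ j
  bounded₁ : IsBoundedKernel ∞ w₁ fun i k => ‖crossGram ψ₁ (canonicalDual φ₁) i k‖ₑ
  bounded₂ : IsBoundedKernel ∞ w₂ fun j l => ‖crossGram ψ₂ (canonicalDual φ₂) j l‖ₑ
  compatible : IsCompatibleNorm N w₁ w₂ (fun i k => ‖crossGram ψ₁ (canonicalDual φ₁) i k‖ₑ)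
    (fun j l => ‖crossGram ψ₂ (canonicalDual φ₂) j l‖ₑ) C

namespace IsTransferable

variable {C C' : ℝ≥0}

theorem isRepresentative (h : IsTransferable N w₁ w₂ ψ₁ φ₁ ψ₂ φ₂ C)
    {F : ℕ → HilbertTensor H₁ H₂} (hF : IsRepresentative N ψ₁ ψ₂ F) :
    IsRepresentative N φ₁ φ₂ F := by
  obtain ⟨hlim, hbd⟩ := hF
  choose κ hκ using hlim
  refine ⟨fun i j => ⟨_, tendsto_analysis h.frame₁ h.frame₂ φ₁ φ₂ h.pos₁ h.pos₂ h.bounded₁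
    h.bounded₂ hbd.ne (fun n k l => (h.compatible.enorm_mul_le _ k l).trans
      (le_iSup (fun n => N (analysis ψ₁ ψ₂ (F n))) n)) hκ i j⟩, ?_⟩
  refine (iSup_le fun n => ?_ : _ ≤ C * ⨆ n, N (analysis ψ₁ ψ₂ (F n))).trans_lt
    (ENNReal.mul_lt_top ENNReal.coe_lt_top hbd)
  refine (h.compatible.apply_le _ _ fun i j =>
    enorm_analysis_le h.frame₁ h.frame₂ φ₁ φ₂ (F n) i j).trans ?_
  gcongr
  exact le_iSup (fun n => N (analysis ψ₁ ψ₂ (F n))) n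

theorem seqEquiv (h : IsTransferable N w₁ w₂ ψ₁ φ₁ ψ₂ φ₂ C)
    {F F' : ℕ → HilbertTensor H₁ H₂} (hF : IsRepresentative N ψ₁ ψ₂ F)
    (hF' : IsRepresentative N ψ₁ ψ₂ F') (hFF' : SeqEquiv ψ₁ ψ₂ F F') :
    SeqEquiv φ₁ φ₂ F F' := by
  intro i j
  -- The limit theorem is applied to the differences, with limit coefficients zero and the sum of
  -- the two suprema as bound.
  have ht := tendsto_analysis h.frame₁ h.frame₂ φ₁ φ₂ h.pos₁ h.pos₂ h.bounded₁ h.bounded₂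
    (F := fun n => F n - F' n) (ENNReal.add_ne_top.2 ⟨hF.2.ne, hF'.2.ne⟩) (fun n k l => ?_)
    hFF' i j
  · simpa using ht
  · have hsub : analysis ψ₁ ψ₂ (F n - F' n) k l
        = analysis ψ₁ ψ₂ (F n) k l - analysis ψ₁ ψ₂ (F' n) k l := inner_sub_right _ _ _
    rw [hsub]
    calc _ ≤ (‖analysis ψ₁ ψ₂ (F n) k l‖ₑ + ‖analysis ψ₁ ψ₂ (F' n) k l‖ₑ) *
          ENNReal.ofReal (w₁ k * w₂ l) := by
          gcongr
          exact enorm_sub_le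
      _ ≤ _ := by
          rw [add_mul]
          exact add_le_add
            ((h.compatible.enorm_mul_le _ k l).trans
              (le_iSup (fun n => N (analysis ψ₁ ψ₂ (F n))) n))
            ((h.compatible.enorm_mul_le _ k l).trans
              (le_iSup (fun n => N (analysis ψ₁ ψ₂ (F' n))) n))

/-- A class contains only representatives for its own frames, so equality of the sets needs the
passage in both directions. -/
theorem seqClass_eq (h : IsTransferable N w₁ w₂ ψ₁ φ₁ ψ₂ φ₂ C)
    (h' : IsTransferable N w₁ w₂ φ₁ ψ₁ φ₂ ψ₂ C') {F : ℕ → HilbertTensor H₁ H₂}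
    (hF : IsRepresentative N ψ₁ ψ₂ F) : seqClass N ψ₁ ψ₂ F = seqClass N φ₁ φ₂ F := by
  ext F'
  constructor
  · rintro ⟨hF', he⟩
    exact ⟨h.isRepresentative hF', h.seqEquiv hF hF' he⟩
  · rintro ⟨hF', he⟩
    exact ⟨h'.isRepresentative hF', h'.seqEquiv (h.isRepresentative hF) hF' he⟩

theorem classSpace_subset (h : IsTransferable N w₁ w₂ ψ₁ φ₁ ψ₂ φ₂ C)
    (h' : IsTransferable N w₁ w₂ φ₁ ψ₁ φ₂ ψ₂ C') :
    (classSpace N ψ₁ ψ₂ : Set (Set (ℕ → HilbertTensor H₁ H₂))) ⊆ classSpace N φ₁ φ₂ := by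
  rintro K ⟨F, hF, rfl⟩
  exact ⟨F, h.isRepresentative hF, h.seqClass_eq h' hF⟩

theorem classCoeff_le (h : IsTransferable N w₁ w₂ ψ₁ φ₁ ψ₂ φ₂ C)
    {K : Set (ℕ → HilbertTensor H₁ H₂)} (hK : K ∈ classSpace N ψ₁ ψ₂)
    (hK' : K ∈ classSpace N φ₁ φ₂) :
    N (classCoeff φ₁ φ₂ K) ≤ C * N (classCoeff ψ₁ ψ₂ K) := by
  obtain ⟨F, hFK, hF⟩ : ∃ F ∈ K, IsRepresentative N ψ₁ ψ₂ F := by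
    obtain ⟨F, hF, rfl⟩ := hK
    exact ⟨F, ⟨hF, fun i j => by simp [analysis]⟩, hF⟩
  refine h.compatible.apply_le _ _ fun i j => ?_
  have h1 := tendsto_classCoeff N φ₁ φ₂ hK' hFK i j
  have h2 := tendsto_analysis h.frame₁ h.frame₂ φ₁ φ₂ h.pos₁ h.pos₂ h.bounded₁
    h.bounded₂ hF.2.ne (fun n k l => (h.compatible.enorm_mul_le _ k l).trans
      (le_iSup (fun n => N (analysis ψ₁ ψ₂ (F n))) n))
    (fun k l => tendsto_classCoeff N ψ₁ ψ₂ hK hFK k l) i j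
  -- Uniqueness of limits: the limit coefficients of `K` obey the same matrix relation as the
  -- coefficients of each `F n`.
  rw [tendsto_nhds_unique h1 h2]
  refine enorm_tsum_le_tsum_enorm.trans_eq ?_
  simp only [ENNReal.tsum_prod', enorm_mul, RCLike.enorm_conj]

/-- The spaces agree, with equivalent norms, if one can pass between the frames both ways. -/
theorem classSpace_eq_and_equivalent (h : IsTransferable N w₁ w₂ ψ₁ φ₁ ψ₂ φ₂ C)
    (h' : IsTransferable N w₁ w₂ φ₁ ψ₁ φ₂ ψ₂ C') :
    (classSpace N ψ₁ ψ₂ : Set (Set (ℕ → HilbertTensor H₁ H₂))) = classSpace N φ₁ φ₂ ∧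
      ∃ C : ℝ≥0, 1 ≤ C ∧ ∀ K ∈ (classSpace N ψ₁ ψ₂ : Set (Set (ℕ → HilbertTensor H₁ H₂))),
        N (classCoeff φ₁ φ₂ K) ≤ C * N (classCoeff ψ₁ ψ₂ K) ∧
        N (classCoeff ψ₁ ψ₂ K) ≤ C * N (classCoeff φ₁ φ₂ K) := by
  have heq := (h.classSpace_subset h').antisymm (h'.classSpace_subset h)
  refine ⟨heq, max 1 (max C C'), le_max_left _ _, fun K hK => ?_⟩
  have hK' := heq ▸ hK
  constructor
  · refine (h.classCoeff_le hK hK').trans ?_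
    gcongr
    exact (le_max_left _ _).trans (le_max_right _ _)
  · refine (h'.classCoeff_le hK' hK).trans ?_
    gcongr
    exact (le_max_right _ _).trans (le_max_right _ _)

end IsTransferable

end Independence

/-! ### Mixed norms -/

section MixedNorm

variable {I J H₁ H₂ : Type*}
  [NormedAddCommGroup H₁] [InnerProductSpace ℂ H₁]
  [NormedAddCommGroup H₂] [InnerProductSpace ℂ H₂]
  {w₁ : I → ℝ} {w₂ : J → ℝ} {ψ₁ φ₁ : I → H₁} {ψ₂ φ₂ : J → H₂}

theorem exists_isCompatibleNorm_mixedNorm (hw₁ : ∀ i, 0 < w₁ i) {p q : ℝ≥0∞}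
    (hp : 1 ≤ p) (hq : 1 ≤ q) {a : I → I → ℝ≥0∞} {b : J → J → ℝ≥0∞}
    (ha : IsBoundedKernel p w₁ a) (hb : IsBoundedKernel q w₂ b) :
    ∃ C, IsCompatibleNorm (mixedNorm p q w₁ w₂) w₁ w₂ a b C := by
  obtain ⟨C, hC⟩ := elpNorm_tensor_kernel_le hw₁ hp hq ha hb
  refine ⟨C, fun c k l => ?_, fun c d hcd => ?_⟩
  · exact (le_elpNorm hp (fun k => ‖c k l‖ₑ * ENNReal.ofReal (w₁ k * w₂ l)) k).trans
      (le_elpNorm hq (fun l => elpNorm p fun k => ‖c k l‖ₑ * ENNReal.ofReal (w₁ k * w₂ l)) l)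
  · refine le_trans (elpNorm_mono fun j => elpNorm_mono fun i => ?_) (hC fun k l => ‖c k l‖ₑ)
    gcongr
    exact hcd i j

/-- Transposition reduces every estimate for the second scale of spaces to the first. -/
theorem mixedNormSwap_eq (p q : ℝ≥0∞) (c : I → J → ℂ) :
    mixedNormSwap p q w₁ w₂ c = mixedNorm p q w₂ w₁ fun j i => c i j := by
  simp only [mixedNormSwap, mixedNorm, mul_comm (w₁ _)]

theorem exists_isCompatibleNorm_mixedNormSwap (hw₂ : ∀ j, 0 < w₂ j) {p q : ℝ≥0∞}
    (hp : 1 ≤ p) (hq : 1 ≤ q) {a : I → I → ℝ≥0∞} {b : J → J → ℝ≥0∞}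
    (ha : IsBoundedKernel q w₁ a) (hb : IsBoundedKernel p w₂ b) :
    ∃ C, IsCompatibleNorm (mixedNormSwap p q w₁ w₂) w₁ w₂ a b C := by
  obtain ⟨C, hC⟩ := exists_isCompatibleNorm_mixedNorm hw₂ hp hq hb ha
  refine ⟨C, fun c k l => ?_, fun c d hcd => ?_⟩
  · rw [mixedNormSwap_eq, mul_comm (w₁ k)]
    exact hC.enorm_mul_le (fun j i => c i j) l k
  · rw [mixedNormSwap_eq, mixedNormSwap_eq]
    refine hC.apply_le _ _ fun j i => (hcd i j).trans_eq ?_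
    rw [ENNReal.tsum_comm]
    exact tsum_congr fun l => tsum_congr fun k => by rw [mul_comm (a i k)]

theorem exists_isTransferable_mixedNorm {𝒜₁ : SpectralMatrixAlgebra I}
    {𝒜₂ : SpectralMatrixAlgebra J} (hψ₁ : IsFrame ψ₁) (hψ₂ : IsFrame ψ₂)
    (hw₁ : IsAdmissibleWeight 𝒜₁ w₁) (hw₂ : IsAdmissibleWeight 𝒜₂ w₂) {p : ℝ≥0∞} (hp : 1 ≤ p)
    (h₁ : crossGram ψ₁ (canonicalDual φ₁) ∈ 𝒜₁.carrier)
    (h₂ : crossGram ψ₂ (canonicalDual φ₂) ∈ 𝒜₂.carrier) :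
    ∃ C, IsTransferable (mixedNorm p ∞ w₁ w₂) w₁ w₂ ψ₁ φ₁ ψ₂ φ₂ C := by
  -- The inner index `i` uses the kernel bound at exponent `p`, the outer index `j` the one at `∞`;
  -- the swapped norm reverses these roles.
  obtain ⟨C, hC⟩ := exists_isCompatibleNorm_mixedNorm hw₁.1 hp le_top
    (hw₁.isBoundedKernel h₁ hp) (hw₂.isBoundedKernel h₂ le_top)
  exact ⟨C, hψ₁, hψ₂, hw₁.1, hw₂.1, hw₁.isBoundedKernel h₁ le_top,
    hw₂.isBoundedKernel h₂ le_top, hC⟩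

theorem exists_isTransferable_mixedNormSwap {𝒜₁ : SpectralMatrixAlgebra I}
    {𝒜₂ : SpectralMatrixAlgebra J} (hψ₁ : IsFrame ψ₁) (hψ₂ : IsFrame ψ₂)
    (hw₁ : IsAdmissibleWeight 𝒜₁ w₁) (hw₂ : IsAdmissibleWeight 𝒜₂ w₂) {p : ℝ≥0∞} (hp : 1 ≤ p)
    (h₁ : crossGram ψ₁ (canonicalDual φ₁) ∈ 𝒜₁.carrier)
    (h₂ : crossGram ψ₂ (canonicalDual φ₂) ∈ 𝒜₂.carrier) :
    ∃ C, IsTransferable (mixedNormSwap p ∞ w₁ w₂) w₁ w₂ ψ₁ φ₁ ψ₂ φ₂ C := by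
  obtain ⟨C, hC⟩ := exists_isCompatibleNorm_mixedNormSwap hw₂.1 hp le_top
    (hw₁.isBoundedKernel h₁ le_top) (hw₂.isBoundedKernel h₂ hp)
  exact ⟨C, hψ₁, hψ₂, hw₁.1, hw₂.1, hw₁.isBoundedKernel h₁ le_top,
    hw₂.isBoundedKernel h₂ le_top, hC⟩

end MixedNorm

end Coorbit

theorem mainTheorem5
    {H₁ H₂ I J : Type*}
    [NormedAddCommGroup H₁] [InnerProductSpace ℂ H₁] [CompleteSpace H₁]
    [NormedAddCommGroup H₂] [InnerProductSpace ℂ H₂] [CompleteSpace H₂]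
    [Countable I] [Countable J]
    (𝒜₁ : Coorbit.SpectralMatrixAlgebra I) (𝒜₂ : Coorbit.SpectralMatrixAlgebra J)
    (ψ₁ φ₁ : I → H₁) (ψ₂ φ₂ : J → H₂)
    (hψ₁ : Coorbit.IsLocalisedFrame 𝒜₁ ψ₁) (hφ₁ : Coorbit.IsLocalisedFrame 𝒜₁ φ₁)
    (hψ₂ : Coorbit.IsLocalisedFrame 𝒜₂ ψ₂) (hφ₂ : Coorbit.IsLocalisedFrame 𝒜₂ φ₂)
    (w₁ : I → ℝ) (w₂ : J → ℝ)
    (hw₁ : Coorbit.IsAdmissibleWeight 𝒜₁ w₁) (hw₂ : Coorbit.IsAdmissibleWeight 𝒜₂ w₂)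
    (p : ℝ≥0∞) (hp : 1 ≤ p)
    (hφψ₁ : Coorbit.crossGram φ₁ (Coorbit.canonicalDual ψ₁) ∈ 𝒜₁.carrier)
    (hψφ₁ : Coorbit.crossGram ψ₁ (Coorbit.canonicalDual φ₁) ∈ 𝒜₁.carrier)
    (hφψ₂ : Coorbit.crossGram φ₂ (Coorbit.canonicalDual ψ₂) ∈ 𝒜₂.carrier)
    (hψφ₂ : Coorbit.crossGram ψ₂ (Coorbit.canonicalDual φ₂) ∈ 𝒜₂.carrier) :
    (Coorbit.coorbitSpace p w₁ w₂ ψ₁ ψ₂ = Coorbit.coorbitSpace p w₁ w₂ φ₁ φ₂ ∧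
      ∃ C : ℝ≥0, 1 ≤ C ∧ ∀ K ∈ Coorbit.coorbitSpace p w₁ w₂ ψ₁ ψ₂,
        Coorbit.coorbitNorm p w₁ w₂ φ₁ φ₂ K ≤ C * Coorbit.coorbitNorm p w₁ w₂ ψ₁ ψ₂ K ∧
        Coorbit.coorbitNorm p w₁ w₂ ψ₁ ψ₂ K ≤ C * Coorbit.coorbitNorm p w₁ w₂ φ₁ φ₂ K) ∧
    (Coorbit.coorbitSpaceSwap p w₁ w₂ ψ₁ ψ₂ = Coorbit.coorbitSpaceSwap p w₁ w₂ φ₁ φ₂ ∧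
      ∃ C : ℝ≥0, 1 ≤ C ∧ ∀ K ∈ Coorbit.coorbitSpaceSwap p w₁ w₂ ψ₁ ψ₂,
        Coorbit.coorbitNormSwap p w₁ w₂ φ₁ φ₂ K
          ≤ C * Coorbit.coorbitNormSwap p w₁ w₂ ψ₁ ψ₂ K ∧
        Coorbit.coorbitNormSwap p w₁ w₂ ψ₁ ψ₂ K
          ≤ C * Coorbit.coorbitNormSwap p w₁ w₂ φ₁ φ₂ K) := by
  obtain ⟨_, h⟩ := Coorbit.exists_isTransferable_mixedNorm hψ₁.1 hψ₂.1 hw₁ hw₂ hp hψφ₁ hψφ₂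
  obtain ⟨_, h'⟩ := Coorbit.exists_isTransferable_mixedNorm hφ₁.1 hφ₂.1 hw₁ hw₂ hp hφψ₁ hφψ₂
  obtain ⟨_, g⟩ := Coorbit.exists_isTransferable_mixedNormSwap hψ₁.1 hψ₂.1 hw₁ hw₂ hp hψφ₁ hψφ₂
  obtain ⟨_, g'⟩ := Coorbit.exists_isTransferable_mixedNormSwap hφ₁.1 hφ₂.1 hw₁ hw₂ hp hφψ₁ hφψ₂
  exact ⟨h.classSpace_eq_and_equivalent h', g.classSpace_eq_and_equivalent g'⟩
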